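/- Let $\mathbb{F}_q$ be a finite field of order $q$ and characteristic $p$, and let $k\ge 1$. An arc in $\mathbb{F}_q^k$ is an ordered family of at least $k$ vectors in which every subfamily of size $k$ is a basis of $\mathbb{F}_q^k$. Two arcs of the same size are linearly equivalent if the matrix whose columns are the vectors of the first can be transformed into that of the second by elementary row operations, column permutations and multiplication of columns by nonzero scalars. The normal rational curve is the family $\mathcal{R}_k=\{(1,t,t^2,\dots,t^{k-1}) : t\in\mathbb{F}_q\}\cup\{(0,\dots,0,1)\}$ of size $q+1$ (in any order). For an arc $G\subset\mathbb{F}_q^k$ with $k\ge 2$, an integer $0\le n\le |G|-k+1$ and a basis $B$ of $\mathbb{F}_q^k$, let $M_G^{\uparrow n}$ be the matrix over $\mathbb{F}_q$ with rows indexed by the $(k-1)$-subsets $C$ of $G$ and columns indexed by the pairs $(U,A)$, where $U\in\binom{G}{n}$ and $A\in\binom{G\setminus U}{k-2}$, whose $(C,(U,A))$-entry is $\prod_{u\in U}\det(u,C)_B$ if $A\subset C\subset G\setminus U$, and $0$ otherwise. Here $\det(u,C)_B$ is the determinant of the matrix whose first row is $u$ and whose last $k-1$ rows are the elements of $C$ in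 the order inherited from $G$, all written with respect to $B$. For $C\in\binom{G}{k-1}$ let $L_C$ be the last $n$-subset of $G\setminus C$ in colex order, and let $J_G^{\uparrow n}$ be the diagonal matrix with $(C,C)$-entry $\prod_{y\in L_C}\det(y,C)_B^{-1}$. Let $H_G^{\uparrow n}=J_G^{\uparrow n}M_G^{\uparrow n}$, with its rows put in colex order. (In colex order, $X$ is smaller than $Y$ if the largest element of the symmetric difference $X\triangle Y$ lies in $Y$.) Theorem. (1) If $k\le p$ and $G\subset\mathbb{F}_q^k$ is an arc of size $2k-2$, then the column space of $H_G^{\uparrow 0}$ contains the vector $v\in\mathbb{F}_q^{\binom{2k-2}{k-1}}$ with $v_i=1$ for $i\in\{1,\dots,k\}$ and $v_i=0$ otherwise. (2) If $k\le p$ and $k\ne (q+1)/2$, then the normal rational curve $\mathcal{R}_k$ is the unique arc in $\mathbb{F}_q^k$ of size $q+1$ up to linear equivalence; that is, $\mathcal{R}_k$ is an arc of size $q+1$, and every arc of size $q+1$ in $\mathbb{F}_q^k$ is linearly equivalent to $\mathcal{R}_k$. -/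

import Mathlib

namespace Arcs

/-- A family of `m ≥ k` vectors of `F ^ k`, ordered by `Fin m`, is an *arc* if every subfamily of
size `k` is a basis of `F ^ k`. -/
def IsArc {F : Type*} [Field F] {k m : ℕ} (G : Fin m → Fin k → F) : Prop :=
  k ≤ m ∧ ∀ I : Finset (Fin m), I.card = k →
    LinearIndependent F (fun i : I => G i) ∧
      Submodule.span F (Set.range fun i : I => G i) = ⊤

/-- Linear equivalence of two families of `m` vectors of `F ^ k`: the matrix whose columns are the
vectors of `G` becomes the one of `G'` by elementary row operations (that is, by multiplication
from the left by an invertible matrix `A`), a permutation `σ` of the columns, and multiplication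
of the columns by nonzero scalars `c j`. -/
def LinearlyEquivalent {F : Type*} [Field F] {k m : ℕ} (G G' : Fin m → Fin k → F) : Prop :=
  ∃ (A : GL (Fin k) F) (σ : Equiv.Perm (Fin m)) (c : Fin m → Fˣ),
    ∀ j, G' j = (c j : F) • Matrix.mulVec (A : Matrix (Fin k) (Fin k) F) (G (σ j))

/-- The normal rational curve: the vectors `(1, t, ..., t ^ (k - 1))`, where `t` runs through `F`
in the order given by `e`, followed by `(0, ..., 0, 1)`. -/
def normalRationalCurve {F : Type*} [Field F] [Fintype F] (k : ℕ) (e : Fin (Fintype.card F) ≃ F) :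
    Fin (Fintype.card F + 1) → Fin k → F :=
  Fin.snoc (α := fun _ => Fin k → F) (fun i j => e i ^ (j : ℕ))
    (fun j => if (j : ℕ) + 1 = k then 1 else 0)

/-- The subsets `C` of size `k - 1` of a family indexed by `Fin m`. -/
abbrev RowIndex (k m : ℕ) : Type := {C : Finset (Fin m) // C.card = k - 1}

/-- The pairs `(U, A)` where `U` is a subset of size `n` of a family `G` indexed by `Fin m`, and
`A` is a subset of size `k - 2` of `G \ U`. -/
abbrev ColIndex (n k m : ℕ) : Type :=
  {P : Finset (Fin m) × Finset (Fin m) // P.1.card = n ∧ P.2.card = k - 2 ∧ P.2 ⊆ P.1ᶜ}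

/-- `det(u, C)_B`: the determinant of the matrix with first row `u` and with the elements of `C`,
in the order inherited from `G`, as last `k - 1` rows, all written in the basis `B`. -/
noncomputable def detWith {F : Type*} [Field F] {k m : ℕ}
    (B : Module.Basis (Fin k) F (Fin k → F)) (G : Fin m → Fin k → F)
    (u : Fin m) (C : RowIndex k m) : F :=
  Matrix.det (Matrix.of fun i j : Fin k =>
    if h : (i : ℕ) = 0 then B.repr (G u) j
    else B.repr (G (C.1.orderEmbOfFin C.2 ⟨(i : ℕ) - 1, by have := i.isLt; omega⟩)) j)

/-- The matrix `M_G^{↑n}`. -/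
noncomputable def matM {F : Type*} [Field F] {k m : ℕ}
    (B : Module.Basis (Fin k) F (Fin k → F)) (G : Fin m → Fin k → F) (n : ℕ) :
    Matrix (RowIndex k m) (ColIndex n k m) F :=
  Matrix.of fun C P =>
    if P.1.2 ⊆ C.1 ∧ C.1 ⊆ P.1.1ᶜ then ∏ u ∈ P.1.1, detWith B G u C else 0

/-- `L_C`: the last subset of size `n` of `G \ C` in colex order
(and `∅` if `G \ C` has fewer than `n` elements). -/
noncomputable def lastSubset {k m : ℕ} (n : ℕ) (C : RowIndex k m) : Finset (Fin m) :=
  if h : ((Finset.powersetCard n (C.1ᶜ)).image toColex).Nonempty then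
    ofColex (((Finset.powersetCard n (C.1ᶜ)).image toColex).max' h)
  else ∅

/-- The diagonal matrix `J_G^{↑n}`. -/
noncomputable def matJ {F : Type*} [Field F] {k m : ℕ}
    (B : Module.Basis (Fin k) F (Fin k → F)) (G : Fin m → Fin k → F) (n : ℕ) :
    Matrix (RowIndex k m) (RowIndex k m) F :=
  Matrix.diagonal fun C => ∏ y ∈ lastSubset n C, (detWith B G y C)⁻¹

/-- The subsets of size `r` of `Fin m`, as elements of the colex order. -/
def colexSubsets (r m : ℕ) : Finset (Colex (Finset (Fin m))) :=
  (Finset.powersetCard r Finset.univ).map toColex.toEmbedding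

theorem card_colexSubsets (r m : ℕ) : (colexSubsets r m).card = m.choose r := by
  simp [colexSubsets]

theorem card_of_mem_colexSubsets {r m : ℕ} {s : Colex (Finset (Fin m))}
    (h : s ∈ colexSubsets r m) : (ofColex s).card = r := by
  obtain ⟨t, ht, rfl⟩ := Finset.mem_map.1 h
  exact (Finset.mem_powersetCard.1 ht).2

/-- The increasing enumeration, in colex order, of the subsets of size `k - 1`. -/
def colexRow (k m : ℕ) (i : Fin (m.choose (k - 1))) : RowIndex k m :=
  ⟨ofColex ((colexSubsets (k - 1) m).orderEmbOfFin (card_colexSubsets (k - 1) m) i),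
    card_of_mem_colexSubsets (Finset.orderEmbOfFin_mem _ _ i)⟩

/-- The matrix `H_G^{↑n} = J_G^{↑n} M_G^{↑n}`, with its rows put in colex order. -/
noncomputable def matH {F : Type*} [Field F] {k m : ℕ}
    (B : Module.Basis (Fin k) F (Fin k → F)) (G : Fin m → Fin k → F) (n : ℕ) :
    Matrix (Fin (m.choose (k - 1))) (ColIndex n k m) F :=
  (matJ B G n * matM B G n).submatrix (colexRow k m) id

end Arcs

namespace Arcs

section Inclusion

variable {F : Type*} [Field F]

/-- Coefficients that express the indicator of the `(r + 1)`-subsets of a set of size `r + 2`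
through inclusions of `r`-subsets. -/
theorem exists_inclusion_coeff (p : ℕ) [CharP F p] (r : ℕ) (hr : r + 1 < p) :
    ∃ f : ℕ → F, ((r + 1 : ℕ) : F) * f 0 = 1 ∧
      ∀ i, i + 1 ≤ r → ((r - i : ℕ) : F) * f (i + 1) + ((i + 1 : ℕ) : F) * f i = 0 := by
  have hne : ∀ m : ℕ, 0 < m → m ≤ r + 1 → (m : F) ≠ 0 := by
    intro m hm hmr h
    rw [CharP.cast_eq_zero_iff F p] at h
    have := Nat.le_of_dvd hm h
    omega
  refine ⟨fun n => Nat.rec (((r + 1 : ℕ) : F)⁻¹)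
    (fun i y => -(((i + 1 : ℕ) : F) * y) * ((r - i : ℕ) : F)⁻¹) n, ?_, ?_⟩
  · exact mul_inv_cancel₀ (hne _ (by omega) le_rfl)
  · intro i hi
    have := hne (r - i) (by omega) (by omega)
    dsimp only
    field_simp
    ring

variable {ι : Type*} [DecidableEq ι]

theorem sum_powersetCard_pred {M : Type*} [AddCommMonoid M] (C : Finset ι) (r : ℕ)
    (hC : C.card = r + 1) (g : Finset ι → M) :
    ∑ A ∈ C.powersetCard r, g A = ∑ x ∈ C, g (C.erase x) := by
  symm
  refine Finset.sum_bij (fun x _ => C.erase x) ?_ ?_ ?_ ?_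
  · intro x hx
    rw [Finset.mem_powersetCard, Finset.card_erase_of_mem hx]
    exact ⟨Finset.erase_subset _ _, by omega⟩
  · intro x hx y hy hxy
    exact Finset.erase_injOn C hx hy hxy
  · intro A hA
    rw [Finset.mem_powersetCard] at hA
    obtain ⟨x, hx⟩ : ∃ x, C \ A = {x} := by
      rw [← Finset.card_eq_one, Finset.card_sdiff_of_subset hA.1]
      omega
    have hxC : x ∈ C \ A := by simp [hx]
    refine ⟨x, (Finset.mem_sdiff.1 hxC).1, ?_⟩
    rw [← Finset.sdiff_singleton_eq_erase, ← hx, Finset.sdiff_sdiff_eq_self hA.1]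
  · intro x _
    rfl

theorem sum_inclusion_coeff {r : ℕ} {f : ℕ → F} (h0 : ((r + 1 : ℕ) : F) * f 0 = 1)
    (hs : ∀ i, i + 1 ≤ r → ((r - i : ℕ) : F) * f (i + 1) + ((i + 1 : ℕ) : F) * f i = 0)
    (K C : Finset ι) (hC : C.card = r + 1) (hCK : (C \ K).card ≤ r) :
    ∑ A ∈ C.powersetCard r, f (A \ K).card = if C ⊆ K then 1 else 0 := by
  rw [sum_powersetCard_pred C r hC]
  have h1 : ∀ x ∈ C ∩ K, f (C.erase x \ K).card = f (C \ K).card := by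
    intro x hx
    rw [Finset.erase_sdiff_comm, Finset.erase_eq_of_notMem]
    simp [(Finset.mem_inter.1 hx).2]
  have h2 : ∀ x ∈ C \ K, f (C.erase x \ K).card = f ((C \ K).card - 1) := by
    intro x hx
    rw [Finset.erase_sdiff_comm, Finset.card_erase_of_mem hx]
  rw [← Finset.sum_inter_add_sum_sdiff C K, Finset.sum_congr rfl h1, Finset.sum_congr rfl h2,
    Finset.sum_const, Finset.sum_const, nsmul_eq_mul, nsmul_eq_mul]
  have hcard := Finset.card_inter_add_card_sdiff C K
  split_ifs with h
  · have h3 : C \ K = ∅ := Finset.sdiff_eq_empty_iff_subset.2 h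
    rw [h3, Finset.card_empty] at hcard ⊢
    rw [show (C ∩ K).card = r + 1 by omega]
    simpa using h0
  · have h3 : (C \ K).card ≠ 0 := by
      rw [Finset.card_ne_zero, Finset.nonempty_iff_ne_empty, Ne, Finset.sdiff_eq_empty_iff_subset]
      exact h
    obtain ⟨i, hi⟩ := Nat.exists_eq_succ_of_ne_zero h3
    rw [hi] at hcard hCK ⊢
    rw [show (C ∩ K).card = r - i by omega]
    simpa using hs i hCK

/-- If `β` sums to zero over the `(r + 1)`-subsets of `H` above each `r`-subset of `H`, then it sums
to zero over the `(r + 1)`-subsets of each `K ⊆ H` of size `r + 2`. -/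
theorem sum_erase_eq_zero (p : ℕ) [CharP F p] {r : ℕ} (hr : r + 1 < p) (H K : Finset ι)
    (hK : K ⊆ H) (hKc : K.card = r + 2) (hHc : H.card = 2 * r + 2) (β : Finset ι → F)
    (hβ : ∀ A ⊆ H, A.card = r → ∑ x ∈ H \ A, β (insert x A) = 0) :
    ∑ x ∈ K, β (K.erase x) = 0 := by
  obtain ⟨f, h0, hs⟩ := exists_inclusion_coeff (F := F) p r hr
  have hsub : ∀ C ∈ H.powersetCard (r + 1), (C \ K).card ≤ r := by
    intro C hC
    have := Finset.card_le_card (Finset.sdiff_subset_sdiff (Finset.mem_powersetCard.1 hC).1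
      (le_refl K))
    rw [Finset.card_sdiff_of_subset hK] at this
    omega
  have e1 : ∑ C ∈ H.powersetCard (r + 1), β C * ∑ A ∈ C.powersetCard r, f (A \ K).card
      = ∑ x ∈ K, β (K.erase x) := by
    rw [← sum_powersetCard_pred K (r + 1) hKc]
    have : ∀ C ∈ H.powersetCard (r + 1), β C * ∑ A ∈ C.powersetCard r, f (A \ K).card
        = if C ⊆ K then β C else 0 := by
      intro C hC
      rw [sum_inclusion_coeff h0 hs K C (Finset.mem_powersetCard.1 hC).2 (hsub C hC)]
      simp
    rw [Finset.sum_congr rfl this, ← Finset.sum_filter]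
    refine Finset.sum_congr ?_ fun _ _ => rfl
    ext C
    simp only [Finset.mem_filter, Finset.mem_powersetCard]
    constructor
    · rintro ⟨⟨_, h⟩, h'⟩
      exact ⟨h', h⟩
    · rintro ⟨h, h'⟩
      exact ⟨⟨h.trans hK, h'⟩, h⟩
  rw [← e1]
  have e2 : ∑ C ∈ H.powersetCard (r + 1), β C * ∑ A ∈ C.powersetCard r, f (A \ K).card
      = ∑ A ∈ H.powersetCard r, f (A \ K).card * ∑ x ∈ H \ A, β (insert x A) := by
    simp only [Finset.mul_sum]
    rw [Finset.sum_congr rfl fun C hC => sum_powersetCard_pred C r (Finset.mem_powersetCard.1 hC).2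
      (fun A => β C * f (A \ K).card), Finset.sum_sigma', Finset.sum_sigma']
    refine Finset.sum_bij' (fun P _ => ⟨P.1.erase P.2, P.2⟩) (fun P _ => ⟨insert P.2 P.1, P.2⟩)
      ?_ ?_ ?_ ?_ ?_
    · rintro ⟨C, x⟩ h
      simp only [Finset.mem_sigma, Finset.mem_powersetCard, Finset.mem_sdiff] at h ⊢
      refine ⟨⟨(Finset.erase_subset _ _).trans h.1.1, ?_⟩, h.1.1 h.2, Finset.notMem_erase _ _⟩
      rw [Finset.card_erase_of_mem h.2]
      omega
    · rintro ⟨A, x⟩ h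
      simp only [Finset.mem_sigma, Finset.mem_powersetCard, Finset.mem_sdiff] at h ⊢
      refine ⟨⟨Finset.insert_subset h.2.1 h.1.1, ?_⟩, Finset.mem_insert_self _ _⟩
      rw [Finset.card_insert_of_notMem h.2.2]
      omega
    · rintro ⟨C, x⟩ h
      simp only [Finset.mem_sigma] at h
      simp [Finset.insert_erase h.2]
    · rintro ⟨A, x⟩ h
      simp only [Finset.mem_sigma, Finset.mem_sdiff] at h
      simp [Finset.erase_insert h.2.2]
    · rintro ⟨C, x⟩ h
      simp only [Finset.mem_sigma] at h
      simp only [Finset.insert_erase h.2]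
      ring
  rw [e2]
  refine Finset.sum_eq_zero fun A hA => ?_
  rw [Finset.mem_powersetCard] at hA
  rw [hβ A hA.1 hA.2, mul_zero]

end Inclusion

section Rows

theorem lastSubset_zero {k m : ℕ} (C : RowIndex k m) : lastSubset 0 C = ∅ := by
  unfold lastSubset
  split_ifs with h
  · simp
  · rfl

theorem matH_zero_apply {F : Type*} [Field F] {k m : ℕ} (B : Module.Basis (Fin k) F (Fin k → F))
    (G : Fin m → Fin k → F) (i : Fin (m.choose (k - 1))) (P : ColIndex 0 k m) :
    matH B G 0 i P = if P.1.2 ⊆ (colexRow k m i).1 then 1 else 0 := by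
  have h1 : P.1.1 = ∅ := Finset.card_eq_zero.1 P.2.1
  have h2 : matJ B G 0 = 1 := by
    unfold matJ
    simp [lastSubset_zero]
  simp only [matH, h2, Matrix.one_mul, Matrix.submatrix_apply, matM, Matrix.of_apply, id, h1]
  simp

theorem colexRow_mono {k m : ℕ} {i j : Fin (m.choose (k - 1))} (h : i ≤ j) :
    toColex (colexRow k m i).1 ≤ toColex (colexRow k m j).1 :=
  ((colexSubsets (k - 1) m).orderEmbOfFin (card_colexSubsets (k - 1) m)).monotone h

/-- The first `k` subsets of size `k - 1` in colex order are those of the first `k` elements. -/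
theorem forall_mem_colexRow_lt_iff {k m : ℕ} (hk : 1 ≤ k) (hkm : k ≤ m)
    (i : Fin (m.choose (k - 1))) :
    (∀ b ∈ (colexRow k m i).1, (b : ℕ) < k) ↔ (i : ℕ) < k := by
  classical
  set T : Finset (Fin (m.choose (k - 1))) :=
    Finset.univ.filter fun i => ∀ b ∈ (colexRow k m i).1, (b : ℕ) < k with hT
  have hmem : ∀ i, i ∈ T ↔ ∀ b ∈ (colexRow k m i).1, (b : ℕ) < k := by simp [hT]
  have hlow : ∀ i j, i ≤ j → j ∈ T → i ∈ T := by
    intro i j hij hj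
    rw [hmem] at hj ⊢
    rcases hkm.eq_or_lt with rfl | hlt
    · exact fun b _ => b.isLt
    · exact Finset.Colex.forall_lt_mono (a := (⟨k, hlt⟩ : Fin m)) (colexRow_mono hij) hj
  have hcard : T.card = k := by
    set K : Finset (Fin m) := Finset.univ.filter fun b => (b : ℕ) < k with hK
    have hKc : K.card = k := by
      rw [hK, Fin.card_filter_val_lt]
      omega
    have : T.card = (K.powersetCard (k - 1)).card := by
      refine Finset.card_bij (fun i _ => (colexRow k m i).1) ?_ ?_ ?_
      · intro i hi
        rw [hmem] at hi
        rw [Finset.mem_powersetCard]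
        refine ⟨fun b hb => ?_, (colexRow k m i).2⟩
        simp [hK, hi b hb]
      · intro i _ j _ hij
        exact ((colexSubsets (k - 1) m).orderEmbOfFin (card_colexSubsets (k - 1) m)).injective
          (congrArg toColex hij)
      · intro C hC
        rw [Finset.mem_powersetCard] at hC
        have h1 : toColex C ∈ colexSubsets (k - 1) m := by
          simp [colexSubsets, hC.2]
        have h2 : toColex C ∈ Set.range ((colexSubsets (k - 1) m).orderEmbOfFin
            (card_colexSubsets (k - 1) m)) := by
          rw [Finset.range_orderEmbOfFin]
          exact h1
        obtain ⟨i, hi⟩ := h2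
        have h3 : (colexRow k m i).1 = C := congrArg ofColex hi
        refine ⟨i, ?_, h3⟩
        rw [hmem, h3]
        intro b hb
        simpa [hK] using hC.1 hb
    rw [this, Finset.card_powersetCard, hKc, Nat.choose_symm_of_eq_add (b := 1) (by omega),
      Nat.choose_one_right]
  rw [← hmem]
  constructor
  · intro hi
    have : Finset.Iic i ⊆ T := fun j hj => hlow j i (Finset.mem_Iic.1 hj) hi
    have := Finset.card_le_card this
    rw [Fin.card_Iic, hcard] at this
    omega
  · intro hi
    by_contra hiT
    have : T ⊆ Finset.Iio i := by
      intro j hj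
      rw [Finset.mem_Iio]
      by_contra hji
      exact hiT (hlow i j (not_lt.1 hji) hj)
    have := Finset.card_le_card this
    rw [Fin.card_Iio, hcard] at this
    omega

theorem exists_mem_span_col_matH {F : Type*} [Field F] (p : ℕ) [CharP F p] (r : ℕ)
    (hr : r + 1 < p) (m : ℕ) (hm : m = 2 * r + 2) (G : Fin m → Fin (r + 2) → F)
    (B : Module.Basis (Fin (r + 2)) F (Fin (r + 2) → F)) :
    ∃ v : Fin (m.choose (r + 2 - 1)) → F,
      v ∈ Submodule.span F (Set.range (matH B G 0).col) ∧
        ∀ i, v i = if (i : ℕ) < r + 2 then 1 else 0 := by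
  classical
  obtain ⟨f, h0, hs⟩ := exists_inclusion_coeff (F := F) p r hr
  set K : Finset (Fin m) := Finset.univ.filter fun b => (b : ℕ) < r + 2 with hK
  have hKc : K.card = r + 2 := by
    rw [hK, Fin.card_filter_val_lt]
    omega
  refine ⟨∑ P : ColIndex 0 (r + 2) m, f (P.1.2 \ K).card • (matH B G 0).col P, ?_, ?_⟩
  · exact Submodule.sum_mem _ fun P _ =>
      Submodule.smul_mem _ _ (Submodule.subset_span (Set.mem_range_self P))
  · intro i
    rw [← if_congr (forall_mem_colexRow_lt_iff (by omega) (by omega) i) rfl rfl, Finset.sum_apply]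
    set C := (colexRow (r + 2) m i).1 with hC
    have hCc : C.card = r + 1 := (colexRow (r + 2) m i).2
    have hCK : (C \ K).card ≤ r := by
      have := Finset.card_le_card (Finset.sdiff_subset_sdiff (Finset.subset_univ C) (le_refl K))
      rw [Finset.card_sdiff_of_subset (Finset.subset_univ K), Finset.card_univ,
        Fintype.card_fin] at this
      omega
    have hiff : (∀ b ∈ C, (b : ℕ) < r + 2) ↔ C ⊆ K := by
      simp [hK, Finset.subset_iff]
    rw [if_congr hiff rfl rfl, ← sum_inclusion_coeff h0 hs K C hCc hCK]
    simp only [Pi.smul_apply, Matrix.col_apply, matH_zero_apply, smul_eq_mul, mul_ite, mul_one,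
      mul_zero]
    rw [← Finset.sum_filter]
    refine Finset.sum_bij (fun P _ => P.1.2) ?_ ?_ ?_ ?_
    · intro P hP
      rw [Finset.mem_powersetCard]
      exact ⟨(Finset.mem_filter.1 hP).2, P.2.2.1⟩
    · rintro ⟨⟨U, A⟩, hP⟩ _ ⟨⟨U', A'⟩, hP'⟩ _ h
      have h1 : U = ∅ := Finset.card_eq_zero.1 hP.1
      have h2 : U' = ∅ := Finset.card_eq_zero.1 hP'.1
      simp only at h
      subst h h1 h2
      rfl
    · intro A hA
      rw [Finset.mem_powersetCard] at hA
      refine ⟨⟨(∅, A), by simp [hA.2]⟩, ?_, rfl⟩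
      simpa using hA.1
    · intro P _
      rfl

end Rows

section Line

variable {F : Type*} [Field F] {ι : Type*} [DecidableEq ι]

theorem prod_erase_sub_eq_neg_one [Fintype F] [DecidableEq F] (x : F) : ∏ y ∈ Finset.univ.erase x, (x - y) = -1 := by
  have h := congrArg Units.val (FiniteField.prod_univ_units_id_eq_neg_one (K := F))
  rw [Units.coe_prod, Units.val_neg, Units.val_one] at h
  rw [← h]
  symm
  refine Finset.prod_bij' (fun u _ => x - (u : F))
    (fun y _ => if h : x - y = 0 then 1 else Units.mk0 (x - y) h) ?_ ?_ ?_ ?_ ?_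
  · intro u _
    simp
  · intro y _
    exact Finset.mem_univ _
  · intro u _
    ext
    simp
  · intro y hy
    have : x - y ≠ 0 := sub_ne_zero.2 (Finset.ne_of_mem_erase hy).symm
    simp [this]
  · intro u _
    simp

/-- Lagrange interpolation of the polynomial whose zeros are the elements of `F` that do not occur
among the `v x`. -/
theorem sum_inv_prod_sub_mul_inv_prod_sub_eq_zero [Fintype F] (v : ι → F) (Z E : Finset ι) (hEZ : E ⊆ Z)
    (hv : Set.InjOn v Z) (hcard : Z.card + E.card = Fintype.card F + 3)
    (hZ : Z.card ≤ Fintype.card F) :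
    ∑ x ∈ E, (∏ y ∈ Z.erase x, (v x - v y))⁻¹ * (∏ y ∈ E.erase x, (v x - v y))⁻¹ = 0 := by
  classical
  set P : Polynomial F := Lagrange.nodal (Z.image v)ᶜ id with hP
  have hdeg : P.degree = ((Fintype.card F - Z.card : ℕ) : WithBot ℕ) := by
    rw [hP, Lagrange.degree_nodal, Finset.card_compl, Finset.card_image_of_injOn hv]
  have h1 := Lagrange.coeff_eq_sum (hv.mono (Finset.coe_subset.2 hEZ)) (P := P)
    (by rw [hdeg]; exact_mod_cast (by omega))
  rw [Polynomial.coeff_eq_zero_of_degree_lt (by rw [hdeg]; exact_mod_cast (by omega))] at h1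
  have h2 : ∀ x ∈ E, (∏ y ∈ Z.erase x, (v x - v y))⁻¹ = - P.eval (v x) := by
    intro x hx
    rw [hP, Lagrange.eval_nodal]
    have h3 : ∏ y ∈ Z.erase x, (v x - v y) = ∏ y ∈ (Z.image v).erase (v x), (v x - y) := by
      have : (Z.image v).erase (v x) = (Z.erase x).image v := by
        ext w
        simp only [Finset.mem_erase, Finset.mem_image]
        constructor
        · rintro ⟨hw, z, hz, rfl⟩
          exact ⟨z, ⟨fun h => hw (by rw [h]), hz⟩, rfl⟩
        · rintro ⟨z, ⟨hzx, hz⟩, rfl⟩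
          exact ⟨fun h => hzx (hv hz (hEZ hx) h), z, hz, rfl⟩
      rw [this, Finset.prod_image]
      exact hv.mono (by simp)
    have h4 := prod_erase_sub_eq_neg_one (v x)
    have h5 : Finset.univ.erase (v x) = (Z.image v).erase (v x) ∪ (Z.image v)ᶜ := by
      ext w
      have : v x ∈ Z.image v := Finset.mem_image_of_mem v (hEZ hx)
      simp only [Finset.mem_erase, Finset.mem_union, Finset.mem_compl, Finset.mem_univ, and_true]
      constructor
      · intro h
        by_cases hw : w ∈ Z.image v
        · exact Or.inl ⟨h, hw⟩
        · exact Or.inr hw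
      · rintro (h | h)
        · exact h.1
        · rintro rfl
          exact h this
    rw [h5, Finset.prod_union (Finset.disjoint_of_subset_left (Finset.erase_subset _ _)
      disjoint_compl_right), ← h3] at h4
    rw [inv_eq_of_mul_eq_one_right]
    simp only [id, mul_neg, h4, neg_neg]
  rw [Finset.sum_congr rfl fun x hx => by rw [h2 x hx]]
  simp only [neg_mul, Finset.sum_neg_distrib, neg_eq_zero]
  simp only [div_eq_mul_inv] at h1
  exact h1.symm

theorem prod_erase_scaled_sub (d : ι → ι → F) (l v : ι → F) (c : F) (X : Finset ι) {x : ι}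
    (hx : x ∈ X) (hX : ∀ y ∈ X, d y x = c * (l x * l y) * (v x - v y))
    (hX2 : 2 ≤ X.card) :
    ∏ y ∈ X.erase x, d y x =
      c ^ (X.card - 1) * l x ^ (X.card - 2) * (∏ y ∈ X, l y) * ∏ y ∈ X.erase x, (v x - v y) := by
  rw [Finset.prod_congr rfl fun y hy => hX y (Finset.mem_of_mem_erase hy),
    Finset.prod_mul_distrib, Finset.prod_mul_distrib, Finset.prod_mul_distrib, Finset.prod_const,
    Finset.prod_const, Finset.card_erase_of_mem hx, ← Finset.mul_prod_erase X l hx]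
  obtain ⟨m, hm⟩ := Nat.exists_eq_add_of_le hX2
  rw [show X.card - 1 = m + 1 by omega, show X.card - 2 = m by omega]
  ring

/-- The relation between the values of a skew form of rank two at `|Z|` pairwise independent
points, for subsets `E` of size `q + 3 - |Z|`. -/
theorem sum_inv_prod_form_eq_zero [Fintype F] (d : ι → ι → F) (hd0 : ∀ x, d x x = 0)
    (hskew : ∀ x y, d x y = - d y x) (Z E : Finset ι) (hEZ : E ⊆ Z)
    (hpl : ∀ a ∈ Z, ∀ b ∈ Z, a ≠ b → ∀ x y, d a b * d x y = d a x * d b y - d a y * d b x)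
    (hne : ∀ x ∈ Z, ∀ y ∈ Z, x ≠ y → d x y ≠ 0)
    (hcard : Z.card + E.card = Fintype.card F + 3) (hZ : Z.card ≤ Fintype.card F) :
    ∑ x ∈ E, (∏ y ∈ Z.erase x, d y x)⁻¹ * (∏ y ∈ E.erase x, d y x)⁻¹ = 0 := by
  classical
  obtain ⟨a, ha, b, hb, hab⟩ : ∃ a ∈ Z, ∃ b ∈ Z, a ≠ b := by
    have : 1 < Z.card := by
      have := Finset.card_le_card hEZ
      omega
    exact Finset.one_lt_card.1 this
  obtain ⟨u, hu⟩ : ∃ u, u ∉ (Z.erase a).image fun x => d b x / d a x := by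
    by_contra! h
    have h1 := Finset.card_le_card (fun u _ => h u : (Finset.univ : Finset F) ⊆ _)
    have h2 := Finset.card_image_le (s := Z.erase a) (f := fun x => d b x / d a x)
    rw [Finset.card_erase_of_mem ha] at h2
    rw [Finset.card_univ] at h1
    have : 0 < Z.card := Finset.card_pos.2 ⟨a, ha⟩
    omega
  set l : ι → F := fun x => d b x - u * d a x with hl
  have hl0 : ∀ x ∈ Z, l x ≠ 0 := by
    intro x hx h
    by_cases hxa : x = a
    · subst hxa
      simp only [hl, hd0, mul_zero, sub_zero] at h
      exact hne b hb x ha hab.symm h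
    · refine hu (Finset.mem_image.2 ⟨x, Finset.mem_erase.2 ⟨hxa, hx⟩, ?_⟩)
      rw [div_eq_iff (hne a ha x hx (Ne.symm hxa))]
      exact sub_eq_zero.1 h
  set v : ι → F := fun x => d a x / l x with hv
  have hab0 := hne a ha b hb hab
  have hform : ∀ x ∈ Z, ∀ y ∈ Z, d y x = -(d a b)⁻¹ * (l x * l y) * (v x - v y) := by
    intro x hx y hy
    have h1 := hpl a ha b hb hab x y
    have h2 : l x * l y * (v x - v y) = d a x * l y - d a y * l x := by
      have := hl0 x hx
      have := hl0 y hy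
      simp only [hv]
      field_simp
    rw [mul_assoc, h2, hskew y x, neg_mul, neg_inj, eq_inv_mul_iff_mul_eq₀ hab0, h1]
    simp only [hl]
    ring
  have hinj : Set.InjOn v Z := by
    intro x hx y hy hxy
    by_contra hne'
    have := hform x hx y hy
    rw [hxy, sub_self, mul_zero] at this
    exact hne y hy x hx (Ne.symm hne') this
  have hmain := sum_inv_prod_sub_mul_inv_prod_sub_eq_zero v Z E hEZ hinj hcard hZ
  have hterm : ∀ x ∈ E, (∏ y ∈ Z.erase x, d y x)⁻¹ * (∏ y ∈ E.erase x, d y x)⁻¹ =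
      ((-(d a b)⁻¹) ^ (Z.card - 1 + (E.card - 1)) * (∏ y ∈ Z, l y) * ∏ y ∈ E, l y)⁻¹ *
        ((∏ y ∈ Z.erase x, (v x - v y))⁻¹ * (∏ y ∈ E.erase x, (v x - v y))⁻¹) := by
    intro x hx
    have hxZ := hEZ hx
    rw [prod_erase_scaled_sub d l v _ Z hxZ (fun y hy => hform x hxZ y hy)
        (by have := Finset.card_le_card hEZ; omega),
      prod_erase_scaled_sub d l v _ E hx
        (fun y hy => hform x hxZ y (hEZ hy)) (by omega), ← mul_inv, ← mul_inv, ← mul_inv]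
    congr 1
    have h1 : l x ^ (Z.card - 2) * l x ^ (E.card - 2) = 1 := by
      rw [← pow_add, show Z.card - 2 + (E.card - 2) = Fintype.card F - 1 by
        have := Finset.card_le_card hEZ
        omega]
      exact FiniteField.pow_card_sub_one_eq_one _ (hl0 x hxZ)
    rw [pow_add]
    linear_combination (-(d a b)⁻¹) ^ (Z.card - 1) * (-(d a b)⁻¹) ^ (E.card - 1) *
      (∏ y ∈ Z, l y) * (∏ y ∈ E, l y) * (∏ y ∈ Z.erase x, (v x - v y)) *
      (∏ y ∈ E.erase x, (v x - v y)) * h1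
  rw [Finset.sum_congr rfl hterm, ← Finset.mul_sum, hmain, mul_zero]

end Line

section Facets

variable {F : Type*} [Field F] {r n : ℕ}

theorem det_vecCons_swap (x y : Fin (r + 2) → F) (w : Fin r → Fin (r + 2) → F) :
    Matrix.detRowAlternating (Matrix.vecCons x (Matrix.vecCons y w)) =
      - Matrix.detRowAlternating (Matrix.vecCons y (Matrix.vecCons x w)) := by
  rw [← AlternatingMap.map_swap _ _ (show (0 : Fin (r + 2)) ≠ 1 by simp)]
  congr 1
  ext i j
  refine Fin.cases ?_ (fun i => Fin.cases ?_ (fun i => ?_) i) i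
  · simp
  · simp
  · have h : Equiv.swap (0 : Fin (r + 2)) 1 i.succ.succ = i.succ.succ :=
      Equiv.swap_apply_of_ne_of_ne (Fin.succ_ne_zero _)
        (fun h => Fin.succ_ne_zero i (Fin.succ_injective _ h))
    rw [Function.comp_apply, h]
    simp

/-- `v ↦ det (v, w)`. -/
noncomputable def detLeft (w : Fin (r + 1) → Fin (r + 2) → F) : (Fin (r + 2) → F) →ₗ[F] F where
  toFun v := Matrix.detRowAlternating (Matrix.vecCons v w)
  map_add' x y := congrArg (fun f => f w)
    ((Matrix.detRowAlternating (R := F) (n := Fin (r + 2))).curryLeft.map_add x y)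
  map_smul' c x := congrArg (fun f => f w)
    ((Matrix.detRowAlternating (R := F) (n := Fin (r + 2))).curryLeft.map_smul c x)

theorem detLeft_apply (w : Fin (r + 1) → Fin (r + 2) → F) (v : Fin (r + 2) → F) :
    detLeft w v = Matrix.detRowAlternating (Matrix.vecCons v w) := rfl

theorem detLeft_comp_perm (w : Fin (r + 1) → Fin (r + 2) → F) (σ : Equiv.Perm (Fin (r + 1))) :
    ∃ ε : F, ε ^ 2 = 1 ∧ ∀ v, detLeft (w ∘ σ) v = ε * detLeft w v := by
  refine ⟨((Equiv.Perm.sign σ : ℤ) : F), ?_, fun v => ?_⟩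
  · rcases Int.units_eq_one_or (Equiv.Perm.sign σ) with h | h <;> simp [h]
  · have := AlternatingMap.map_perm
      ((Matrix.detRowAlternating (R := F) (n := Fin (r + 2))).curryLeft v) w σ
    simp only [AlternatingMap.curryLeft_apply_apply] at this
    rw [detLeft_apply, detLeft_apply, this, Units.smul_def, zsmul_eq_mul]

theorem detLeft_self (w : Fin (r + 1) → Fin (r + 2) → F) (i : Fin (r + 1)) :
    detLeft w (w i) = 0 := by
  rw [detLeft_apply]
  exact AlternatingMap.map_eq_zero_of_eq _ _ (i := 0) (j := i.succ) (by simp)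
    (Fin.succ_ne_zero i).symm

theorem det_ne_zero_of_linearIndependent {w : Fin (r + 2) → Fin (r + 2) → F}
    (hw : LinearIndependent F w) : Matrix.detRowAlternating w ≠ 0 := by
  have : IsUnit (Matrix.of w) := Matrix.linearIndependent_rows_iff_isUnit.1 hw
  exact ((Matrix.isUnit_iff_isUnit_det _).1 this).ne_zero

theorem detLeft_plucker (w : Fin r → Fin (r + 2) → F) (a b x y : Fin (r + 2) → F)
    (hli : LinearIndependent F (Matrix.vecCons a (Matrix.vecCons b w))) :
    detLeft (Matrix.vecCons b w) a * detLeft (Matrix.vecCons y w) x =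
      detLeft (Matrix.vecCons x w) a * detLeft (Matrix.vecCons y w) b -
        detLeft (Matrix.vecCons y w) a * detLeft (Matrix.vecCons x w) b := by
  have htop : Submodule.span F (Set.range (Matrix.vecCons a (Matrix.vecCons b w))) = ⊤ :=
    hli.span_eq_top_of_card_eq_finrank (by simp)
  have hx : x ∈ Submodule.span F (Set.range (Matrix.vecCons a (Matrix.vecCons b w))) := by
    rw [htop]
    trivial
  rw [Matrix.range_cons, Matrix.range_cons, Set.singleton_union, Set.singleton_union,
    Submodule.mem_span_insert] at hx
  obtain ⟨s, z, hz, rfl⟩ := hx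
  obtain ⟨t, z', hz', rfl⟩ := Submodule.mem_span_insert.1 hz
  have h0 : ∀ y, detLeft (Matrix.vecCons y w) z' = 0 := by
    intro y
    have : Submodule.span F (Set.range w) ≤ LinearMap.ker (detLeft (Matrix.vecCons y w)) := by
      rw [Submodule.span_le]
      rintro _ ⟨i, rfl⟩
      exact detLeft_self (Matrix.vecCons y w) i.succ
    exact this hz'
  have hsk : ∀ x y, detLeft (Matrix.vecCons x w) y = - detLeft (Matrix.vecCons y w) x :=
    fun x y => det_vecCons_swap y x w
  have hs : ∀ x, detLeft (Matrix.vecCons x w) x = 0 := fun x => detLeft_self (Matrix.vecCons x w) 0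
  rw [hsk (s • a + (t • b + z')) a, hsk (s • a + (t • b + z')) b]
  simp only [map_add, map_smul, h0, hs, smul_eq_mul]
  rw [hsk a b]
  ring

/-- The linear functional `v ↦ det (v, C)` for a subset `C` of size `r + 1` of the family `S`. -/
noncomputable def facet (S : Fin n → Fin (r + 2) → F) (C : Finset (Fin n)) :
    (Fin (r + 2) → F) →ₗ[F] F :=
  if h : C.card = r + 1 then detLeft (S ∘ C.orderEmbOfFin h) else 0

theorem facet_of_card {S : Fin n → Fin (r + 2) → F} {C : Finset (Fin n)} (h : C.card = r + 1) :
    facet S C = detLeft (S ∘ C.orderEmbOfFin h) := by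
  rw [facet, dif_pos h]

theorem facet_self (S : Fin n → Fin (r + 2) → F) {C : Finset (Fin n)} {y : Fin n} (hy : y ∈ C) :
    facet S C (S y) = 0 := by
  by_cases h : C.card = r + 1
  · rw [facet_of_card h]
    have : y ∈ Set.range (C.orderEmbOfFin h) := by
      rw [Finset.range_orderEmbOfFin]
      exact hy
    obtain ⟨i, rfl⟩ := this
    exact detLeft_self (S ∘ C.orderEmbOfFin h) i
  · rw [facet, dif_neg h, LinearMap.zero_apply]

/-- Every `k` vectors of the family are linearly independent. -/
def General {k : ℕ} (S : Fin n → Fin k → F) : Prop :=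
  ∀ I : Finset (Fin n), I.card = k → LinearIndependent F fun i : I => S i

theorem General.comp {k : ℕ} {S : Fin n → Fin k → F} (hS : General S) {m : ℕ} (hmk : m ≤ k)
    (hkn : k ≤ n) {f : Fin m → Fin n} (hf : Function.Injective f) :
    LinearIndependent F (S ∘ f) := by
  have hc : (Finset.univ.image f).card = m := by
    rw [Finset.card_image_of_injective _ hf, Finset.card_univ, Fintype.card_fin]
  obtain ⟨I, hI, hIc⟩ := Finset.exists_superset_card_eq (s := Finset.univ.image f) (n := k)
    (by omega) (by simpa using hkn)
  have h := (hS I hIc).comp (fun i => ⟨f i, hI (Finset.mem_image_of_mem f (Finset.mem_univ i))⟩)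
    (fun i j hij => hf (congrArg Subtype.val hij))
  exact h

theorem facet_ne_zero {S : Fin n → Fin (r + 2) → F} (hS : General S) {C : Finset (Fin n)}
    (h : C.card = r + 1) {y : Fin n} (hy : y ∉ C) : facet S C (S y) ≠ 0 := by
  rw [facet_of_card h, detLeft_apply]
  have hn : r + 2 ≤ n := by
    have := Finset.card_le_univ (insert y C)
    rw [Finset.card_insert_of_notMem hy, Fintype.card_fin] at this
    omega
  have hinj : Function.Injective (Fin.cons y (C.orderEmbOfFin h) : Fin (r + 2) → Fin n) := by
    rw [Fin.cons_injective_iff, Finset.range_orderEmbOfFin]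
    exact ⟨hy, (C.orderEmbOfFin h).injective⟩
  have h1 := det_ne_zero_of_linearIndependent (hS.comp le_rfl hn hinj)
  convert h1 using 2
  ext i j
  refine Fin.cases ?_ (fun i => ?_) i <;> simp

theorem facet_insert (S : Fin n → Fin (r + 2) → F) {A : Finset (Fin n)} (hA : A.card = r)
    {x : Fin n} (hx : x ∉ A) :
    ∃ ε : F, ε ^ 2 = 1 ∧ ∀ v, facet S (insert x A) v =
      ε * detLeft (Matrix.vecCons (S x) (S ∘ A.orderEmbOfFin hA)) v := by
  have hC : (insert x A).card = r + 1 := by rw [Finset.card_insert_of_notMem hx, hA]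
  set e := (insert x A).orderEmbOfFin hC with he
  set g : Fin (r + 1) → Fin n := Fin.cons x (A.orderEmbOfFin hA) with hg
  have hginj : Function.Injective g := by
    rw [hg, Fin.cons_injective_iff, Finset.range_orderEmbOfFin]
    exact ⟨hx, (A.orderEmbOfFin hA).injective⟩
  have hrange : Set.range e = Set.range g := by
    rw [hg, Fin.range_cons, he, Finset.range_orderEmbOfFin, Finset.range_orderEmbOfFin,
      Finset.coe_insert]
  set σ : Equiv.Perm (Fin (r + 1)) := ((Equiv.ofInjective e e.injective).trans
    (Equiv.setCongr hrange)).trans (Equiv.ofInjective g hginj).symm with hσ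
  have hgσ : ∀ i, g (σ i) = e i := by
    intro i
    exact congrArg Subtype.val ((Equiv.ofInjective g hginj).apply_symm_apply
      ((Equiv.setCongr hrange) (Equiv.ofInjective e e.injective i)))
  obtain ⟨ε, hε, h⟩ := detLeft_comp_perm (S ∘ g) σ
  refine ⟨ε, hε, fun v => ?_⟩
  rw [facet_of_card hC]
  have h1 : S ∘ ((insert x A).orderEmbOfFin hC) = (S ∘ g) ∘ σ := by
    ext i : 1
    simp only [Function.comp_apply, hgσ, he]
  have h2 : Matrix.vecCons (S x) (S ∘ A.orderEmbOfFin hA) = S ∘ g := by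
    ext i j
    refine Fin.cases ?_ (fun i => ?_) i <;> simp [hg]
  rw [h1, h2, h]

end Facets

section Relation

variable {F : Type*} [Field F] [Fintype F] {r n : ℕ}

/-- The weight of a facet `C` of a subfamily `H` of the family `S`. -/
noncomputable def facetWeight (S : Fin n → Fin (r + 2) → F) (H C : Finset (Fin n)) : F :=
  (∏ y ∈ Cᶜ, facet S C (S y))⁻¹ * (∏ y ∈ H \ C, facet S C (S y))⁻¹

theorem sum_facetWeight_insert_eq_zero (hr : 1 ≤ r) (hn : n = Fintype.card F + 1)
    {S : Fin n → Fin (r + 2) → F} (hS : General S) (H : Finset (Fin n)) (hH : H.card = 2 * r + 2)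
    (A : Finset (Fin n)) (hAH : A ⊆ H) (hA : A.card = r) :
    ∑ x ∈ H \ A, facetWeight S H (insert x A) = 0 := by
  classical
  set w := S ∘ A.orderEmbOfFin hA with hw
  set d : Fin n → Fin n → F := fun y x => detLeft (Matrix.vecCons (S x) w) (S y) with hd
  have hHn : 2 * r + 2 ≤ n := by
    have := Finset.card_le_univ H
    rwa [hH, Fintype.card_fin] at this
  have hZ : (Aᶜ).card = n - r := by rw [Finset.card_compl, hA, Fintype.card_fin]
  have hE : (H \ A).card = r + 2 := by rw [Finset.card_sdiff_of_subset hAH]; omega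
  have hli : ∀ x ∈ Aᶜ, ∀ y ∈ Aᶜ, x ≠ y →
      LinearIndependent F (Matrix.vecCons (S x) (Matrix.vecCons (S y) w)) := by
    intro x hx y hy hxy
    have hinj : Function.Injective
        (Fin.cons x (Fin.cons y (A.orderEmbOfFin hA) : Fin (r + 1) → Fin n) :
          Fin (r + 2) → Fin n) := by
      rw [Fin.cons_injective_iff, Fin.cons_injective_iff, Fin.range_cons,
        Finset.range_orderEmbOfFin]
      refine ⟨?_, Finset.mem_compl.1 hy, (A.orderEmbOfFin hA).injective⟩
      simpa [hxy] using Finset.mem_compl.1 hx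
    have h1 := hS.comp le_rfl (by omega) hinj
    convert h1 using 1
    ext i j
    refine Fin.cases ?_ (fun i => Fin.cases ?_ (fun i => ?_) i) i <;> simp [hw]
  have hmain := sum_inv_prod_form_eq_zero d (fun x => detLeft_self (Matrix.vecCons (S x) w) 0)
    (fun x y => det_vecCons_swap (S x) (S y) w) Aᶜ (H \ A)
    (fun x hx => Finset.mem_compl.2 (Finset.mem_sdiff.1 hx).2)
    (fun a ha b hb hab x y => detLeft_plucker w (S a) (S b) (S x) (S y) (hli a ha b hb hab))
    (fun x hx y hy hxy => det_ne_zero_of_linearIndependent (hli x hx y hy hxy))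
    (by omega) (by omega)
  rw [← hmain]
  refine Finset.sum_congr rfl fun x hx => ?_
  rw [Finset.mem_sdiff] at hx
  obtain ⟨ε, hε, hfac⟩ := facet_insert S hA hx.2
  have e1 : (insert x A)ᶜ = (Aᶜ).erase x := by
    ext y
    simp
  have e2 : H \ insert x A = (H \ A).erase x := by
    ext y
    simp only [Finset.mem_sdiff, Finset.mem_insert, Finset.mem_erase]
    tauto
  have hprod : ∀ X : Finset (Fin n), ∏ y ∈ X, facet S (insert x A) (S y) =
      ε ^ X.card * ∏ y ∈ X, d y x := by
    intro X
    rw [Finset.prod_congr rfl fun y _ => hfac (S y), Finset.prod_mul_distrib, Finset.prod_const]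
  have hεq : ε ^ ((Aᶜ).erase x).card * ε ^ ((H \ A).erase x).card = 1 := by
    rw [← pow_add, Finset.card_erase_of_mem (Finset.mem_compl.2 hx.2),
      Finset.card_erase_of_mem (Finset.mem_sdiff.2 hx), hZ, hE,
      show n - r - 1 + (r + 2 - 1) = Fintype.card F + 1 by omega, pow_succ, FiniteField.pow_card,
      ← pow_two, hε]
  rw [facetWeight, e1, e2, hprod, hprod, ← mul_inv, ← mul_inv]
  congr 1
  linear_combination ((∏ y ∈ (Aᶜ).erase x, d y x) * ∏ y ∈ (H \ A).erase x, d y x) * hεq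

theorem sum_facetWeight_erase_eq_zero (p : ℕ) [CharP F p] (hrp : r + 1 < p) (hr : 1 ≤ r)
    (hn : n = Fintype.card F + 1) {S : Fin n → Fin (r + 2) → F} (hS : General S)
    (K L : Finset (Fin n)) (hK : K.card = r + 2) (hL : L.card = r) (hKL : Disjoint K L) :
    ∑ x ∈ K, facetWeight S (K ∪ L) (K.erase x) = 0 := by
  have hH : (K ∪ L).card = 2 * r + 2 := by
    rw [Finset.card_union_of_disjoint hKL]
    omega
  exact sum_erase_eq_zero p hrp (K ∪ L) K Finset.subset_union_left hK hH _
    fun A hAH hA => sum_facetWeight_insert_eq_zero hr hn hS _ hH A hAH hA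

/-- In coordinates with respect to `r + 2` vectors of the family, the products of the inverses of
any `r` other vectors satisfy one linear relation with nonzero coefficients. -/
theorem exists_coord_relation (p : ℕ) [CharP F p] (hrp : r + 1 < p) (hr : 1 ≤ r)
    (hn : n = Fintype.card F + 1) {S : Fin n → Fin (r + 2) → F} (hS : General S)
    (κ : Fin (r + 2) ↪ Fin n) (b : Module.Basis (Fin (r + 2)) F (Fin (r + 2) → F))
    (hb : ∀ i, b i = S (κ i)) :
    ∃ a : Fin (r + 2) → F, (∀ i, a i ≠ 0) ∧
      ∀ L : Finset (Fin n), L.card = r → (∀ i, κ i ∉ L) →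
        ∑ i, a i * ∏ y ∈ L, (b.repr (S y) i)⁻¹ = 0 := by
  set K := Finset.univ.map κ with hK
  have hKc : K.card = r + 2 := by simp [hK]
  have hmem : ∀ i, κ i ∈ K := fun i => Finset.mem_map_of_mem κ (Finset.mem_univ i)
  have hCc : ∀ i, (K.erase (κ i)).card = r + 1 := fun i => by
    rw [Finset.card_erase_of_mem (hmem i), hKc]
    rfl
  set D : Fin (r + 2) → F := fun i => facet S (K.erase (κ i)) (S (κ i)) with hD
  have hD0 : ∀ i, D i ≠ 0 := fun i => facet_ne_zero hS (hCc i) (Finset.notMem_erase _ _)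
  have hcoord : ∀ i v, facet S (K.erase (κ i)) v = D i * b.repr v i := by
    intro i v
    conv_lhs => rw [← b.sum_repr v]
    rw [map_sum, Finset.sum_eq_single i]
    · rw [map_smul, hb, smul_eq_mul, mul_comm]
    · intro j _ hji
      rw [map_smul, hb, facet_self, smul_zero]
      exact Finset.mem_erase.2 ⟨fun h => hji (κ.injective h), hmem j⟩
    · exact fun h => absurd (Finset.mem_univ i) h
  refine ⟨fun i => (∏ y ∈ Kᶜ, facet S (K.erase (κ i)) (S y))⁻¹ * (D i)⁻¹ * (D i)⁻¹ *
    ((D i) ^ r)⁻¹, fun i => ?_, fun L hL hκL => ?_⟩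
  · have h1 : ∏ y ∈ Kᶜ, facet S (K.erase (κ i)) (S y) ≠ 0 := by
      refine Finset.prod_ne_zero_iff.2 fun y hy => facet_ne_zero hS (hCc i) ?_
      intro h
      exact (Finset.mem_compl.mp hy) (Finset.mem_of_mem_erase h)
    have h2 := hD0 i
    exact mul_ne_zero (mul_ne_zero (mul_ne_zero (inv_ne_zero h1) (inv_ne_zero h2))
      (inv_ne_zero h2)) (inv_ne_zero (pow_ne_zero _ h2))
  · have hKL : Disjoint K L := by
      rw [Finset.disjoint_left]
      intro x hx
      obtain ⟨i, _, rfl⟩ := Finset.mem_map.1 hx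
      exact hκL i
    rw [← sum_facetWeight_erase_eq_zero p hrp hr hn hS K L hKc hL hKL, hK, Finset.sum_map, ← hK]
    refine Finset.sum_congr rfl fun i _ => ?_
    have e1 : (K.erase (κ i))ᶜ = insert (κ i) Kᶜ := by
      ext y
      simp only [Finset.mem_compl, Finset.mem_erase, Finset.mem_insert]
      tauto
    have e2 : (K ∪ L) \ K.erase (κ i) = insert (κ i) L := by
      ext y
      have h1 := hmem i
      have h2 : y ∈ K → y ∉ L := fun h => Finset.disjoint_left.1 hKL h
      simp only [Finset.mem_sdiff, Finset.mem_union, Finset.mem_erase, Finset.mem_insert]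
      constructor
      · rintro ⟨h | h, h'⟩
        · left
          by_contra hne
          exact h' ⟨hne, h⟩
        · exact Or.inr h
      · rintro (rfl | h)
        · exact ⟨Or.inl h1, fun h => h.1 rfl⟩
        · exact ⟨Or.inr h, fun h' => h2 h'.2 h⟩
    rw [facetWeight, e1, e2, Finset.prod_insert (by simp [hmem i]), Finset.prod_insert (hκL i)]
    have e3 : ∏ y ∈ L, facet S (K.erase (κ i)) (S y) = D i ^ r * ∏ y ∈ L, b.repr (S y) i := by
      rw [Finset.prod_congr rfl fun y _ => hcoord i (S y), Finset.prod_mul_distrib,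
        Finset.prod_const, hL]
    rw [e3, Finset.prod_inv_distrib]
    simp only [mul_inv]
    change _ = (D i)⁻¹ * _ * ((D i)⁻¹ * _)
    ring

end Relation

section Equivalence

variable {F : Type*} [Field F] {n : ℕ}

theorem General.isArc {k : ℕ} {S : Fin n → Fin k → F} (hkn : k ≤ n) (hS : General S) :
    IsArc S :=
  ⟨hkn, fun I hI => ⟨hS I hI,
    (hS I hI).span_eq_top_of_card_eq_finrank' (by simp [hI])⟩⟩

theorem IsArc.general {k : ℕ} {S : Fin n → Fin k → F} (hS : IsArc S) : General S :=
  fun I hI => (hS.2 I hI).1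

theorem IsArc.span_range_eq_top {k : ℕ} {S : Fin n → Fin k → F} (hS : IsArc S) :
    Submodule.span F (Set.range S) = ⊤ := by
  obtain ⟨I, -, hI⟩ := Finset.exists_subset_card_eq (s := (Finset.univ : Finset (Fin n))) (n := k)
    (by simpa using hS.1)
  rw [eq_top_iff, ← (hS.2 I hI).2]
  apply Submodule.span_mono
  rintro _ ⟨i, rfl⟩
  exact Set.mem_range_self _

theorem IsArc.linearIndependent_pair {k : ℕ} {S : Fin n → Fin k → F} (hS : IsArc S) (hk : 2 ≤ k)
    {x y : Fin n} (hxy : x ≠ y) : LinearIndependent F ![S x, S y] := by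
  have hinj : Function.Injective ![x, y] := by
    intro i j
    fin_cases i <;> fin_cases j <;> simp [hxy, hxy.symm]
  convert hS.general.comp hk hS.1 hinj using 1
  ext i j
  fin_cases i <;> rfl

/-- An arc whose vectors are multiples of the images of vectors of a family of the same size under
a linear map is linearly equivalent to this family. -/
theorem IsArc.linearlyEquivalent {k : ℕ} {S R : Fin n → Fin k → F} (hS : IsArc S) (hk : 2 ≤ k)
    (L : (Fin k → F) →ₗ[F] (Fin k → F)) (h : ∀ y, ∃ (j : Fin n) (c : F), S y = c • L (R j)) :
    LinearlyEquivalent S R := by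
  choose τ c hτ using h
  have hc : ∀ y, c y ≠ 0 := by
    intro y hy
    by_cases hn : ∃ z, z ≠ y
    · obtain ⟨z, hz⟩ := hn
      have := (hS.linearIndependent_pair hk hz).ne_zero 1
      simp [hτ y, hy] at this
    · push Not at hn
      have := Fintype.card_le_one_iff.2 fun a b => (hn a).trans (hn b).symm
      have := hS.1
      simp_all
      omega
  have hinj : Function.Injective τ := by
    intro x y hxy
    by_contra hne
    have h1 := LinearIndependent.pair_iff.1 (hS.linearIndependent_pair hk hne) (c y) (-c x)
      (by rw [hτ x, hτ y, hxy, smul_smul, smul_smul, neg_mul, mul_comm (c x), neg_smul,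
        add_neg_cancel])
    exact hc y h1.1
  set σ : Equiv.Perm (Fin n) := Equiv.ofBijective τ (Finite.injective_iff_bijective.1 hinj) with hσ
  have hsurj : Function.Surjective L := by
    rw [← LinearMap.range_eq_top, eq_top_iff, ← hS.span_range_eq_top, Submodule.span_le]
    rintro _ ⟨y, rfl⟩
    exact ⟨c y • R (τ y), by rw [map_smul, ← hτ]⟩
  have hbij : Function.Injective L ∧ Function.Surjective L :=
    ⟨LinearMap.injective_iff_surjective.2 hsurj, hsurj⟩
  set E : (Fin k → F) ≃ₗ[F] (Fin k → F) := LinearEquiv.ofBijective L hbij with hE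
  refine ⟨⟨LinearMap.toMatrix' E.symm.toLinearMap, LinearMap.toMatrix' E.toLinearMap, ?_, ?_⟩,
    σ.symm, fun j => (Units.mk0 _ (hc (σ.symm j)))⁻¹, fun j => ?_⟩
  · rw [← LinearMap.toMatrix'_comp, LinearEquiv.symm_comp, LinearMap.toMatrix'_id]
  · rw [← LinearMap.toMatrix'_comp, LinearEquiv.comp_symm, LinearMap.toMatrix'_id]
  have h2 : S (σ.symm j) = c (σ.symm j) • E (R j) := by
    have h3 : τ (σ.symm j) = j := σ.apply_symm_apply j
    have h4 := hτ (σ.symm j)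
    rw [h3] at h4
    exact h4
  rw [LinearMap.toMatrix'_mulVec, h2, LinearEquiv.coe_coe, map_smul, E.symm_apply_apply, smul_smul, Units.val_inv_eq_inv_val, Units.val_mk0,
    inv_mul_cancel₀ (hc _), one_smul]

end Equivalence

section RationalCurve

variable {F : Type*} [Field F] [Fintype F] {k : ℕ}

theorem normalRationalCurve_castSucc (e : Fin (Fintype.card F) ≃ F) (i : Fin (Fintype.card F)) :
    normalRationalCurve k e i.castSucc = fun j : Fin k => e i ^ (j : ℕ) := by
  simp [normalRationalCurve]

theorem normalRationalCurve_last (e : Fin (Fintype.card F) ≃ F) :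
    normalRationalCurve k e (Fin.last _) = fun j : Fin k => if (j : ℕ) + 1 = k then 1 else 0 := by
  simp [normalRationalCurve]

theorem isArc_normalRationalCurve (hkq : k ≤ Fintype.card F + 1)
    (e : Fin (Fintype.card F) ≃ F) : IsArc (normalRationalCurve k e) := by
  classical
  refine General.isArc hkq fun I hI => ?_
  set f := I.orderIsoOfFin hI with hf
  rw [← linearIndependent_equiv f.toEquiv]
  set v : Fin (Fintype.card F + 1) → F := Fin.snoc (α := fun _ => F) e 1 with hv
  set w : Fin (Fintype.card F + 1) → F := Fin.snoc (α := fun _ => F) (fun _ => 1) 0 with hw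
  have hR : ∀ i : Fin (Fintype.card F + 1), ∀ j : Fin k,
      normalRationalCurve k e i j = v i ^ (j : ℕ) * w i ^ (j.rev : ℕ) := by
    intro i j
    refine Fin.lastCases ?_ (fun i => ?_) i
    · rw [normalRationalCurve_last]
      simp only [hv, hw, Fin.snoc_last, one_pow, one_mul, zero_pow_eq, Fin.val_rev]
      congr 1
      have := j.isLt
      apply propext
      omega
    · rw [normalRationalCurve_castSucc]
      simp [hv, hw]
  have h1 : (fun i : I => normalRationalCurve k e i) ∘ f.toEquiv =
      Matrix.projVandermonde (fun i => v (f i)) (fun i => w (f i)) := by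
    ext i j
    rw [Matrix.projVandermonde_apply]
    exact hR _ _
  rw [h1]
  apply Matrix.linearIndependent_rows_of_det_ne_zero
  rw [Matrix.det_projVandermonde]
  refine Finset.prod_ne_zero_iff.2 fun i _ => Finset.prod_ne_zero_iff.2 fun j hj => ?_
  have hij : ((f i : I) : Fin (Fintype.card F + 1)) ≠ (f j : I) := by
    intro h
    exact (Finset.mem_Ioi.1 hj).ne (f.injective (Subtype.ext h))
  generalize ((f i : I) : Fin (Fintype.card F + 1)) = x at hij
  generalize ((f j : I) : Fin (Fintype.card F + 1)) = y at hij
  revert hij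
  refine Fin.lastCases ?_ (fun x => ?_) x <;> refine Fin.lastCases ?_ (fun y => ?_) y
  · simp
  · simp [hv, hw]
  · simp [hv, hw]
  · intro hxy
    simp only [hv, hw, Fin.snoc_castSucc, mul_one, sub_ne_zero]
    exact fun h => hxy (by rw [e.injective h])

end RationalCurve

section Direct

variable {F : Type*} [Field F] {r n : ℕ}

/-- The coordinatewise inverses of the vectors outside a basis contained in a large arc lie in a
space of dimension two. -/
theorem exists_inv_coord_eq [Fintype F] (p : ℕ) [CharP F p] (hrp : r + 1 < p)
    (hn : n = Fintype.card F + 1) (hq : 2 * r + 4 ≤ Fintype.card F)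
    {S : Fin n → Fin (r + 2) → F} (hS : IsArc S)
    (κ : Fin (r + 2) ↪ Fin n) (b : Module.Basis (Fin (r + 2)) F (Fin (r + 2) → F))
    (hb : ∀ i, b i = S (κ i)) (hb0 : ∀ y, (∀ i, κ i ≠ y) → ∀ i, b.repr (S y) i ≠ 0)
    {y₀ y₁ y : Fin n} (h01 : y₀ ≠ y₁) (hy₀ : ∀ i, κ i ≠ y₀) (hy₁ : ∀ i, κ i ≠ y₁)
    (hy : ∀ i, κ i ≠ y) :
    ∃ s t : F, ∀ i,
      (b.repr (S y) i)⁻¹ = s * (b.repr (S y₀) i)⁻¹ + t * (b.repr (S y₁) i)⁻¹ := by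
  classical
  obtain ⟨T, hT, hTc⟩ : ∃ T ⊆ ((Finset.univ.map κ) ∪ {y, y₀, y₁})ᶜ, T.card = r := by
    apply Finset.exists_subset_card_eq
    rw [Finset.card_compl, Fintype.card_fin]
    have h1 := Finset.card_union_le (Finset.univ.map κ) {y, y₀, y₁}
    have h2 : ({y, y₀, y₁} : Finset (Fin n)).card ≤ 3 := Finset.card_le_three
    rw [Finset.card_map, Finset.card_univ, Fintype.card_fin] at h1
    omega
  have hTκ : ∀ u ∈ T, ∀ i, κ i ≠ u := by
    intro u hu i h
    have := hT hu
    simp only [Finset.mem_compl, Finset.mem_union, not_or] at this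
    exact this.1 (h ▸ Finset.mem_map_of_mem κ (Finset.mem_univ i))
  have hTy : y ∉ T ∧ y₀ ∉ T ∧ y₁ ∉ T := by
    refine ⟨fun h => ?_, fun h => ?_, fun h => ?_⟩ <;> simpa using hT h
  set z : Fin n → Fin (r + 2) → F := fun x i => (b.repr (S x) i)⁻¹ with hz
  obtain ⟨g, hg0, hg⟩ : ∃ g : Fin (r + 2) → F, (∀ i, g i ≠ 0) ∧
      ∀ u ∈ T, ∀ x, (∀ i, κ i ≠ x) → x ∉ T → ∑ i, g i * b.repr (S u) i * z x i = 0 := by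
    rcases Nat.eq_zero_or_pos r with hr | hr
    · refine ⟨1, by simp, fun u hu => ?_⟩
      rw [hr, Finset.card_eq_zero] at hTc
      simp [hTc] at hu
    · obtain ⟨a, ha0, ha⟩ := exists_coord_relation p hrp hr hn hS.general κ b hb
      refine ⟨fun i => a i * ∏ y ∈ T, z y i, fun i => mul_ne_zero (ha0 i) ?_, ?_⟩
      · exact Finset.prod_ne_zero_iff.2 fun u hu => inv_ne_zero (hb0 u (hTκ u hu) i)
      · intro u hu x hx hxT
        have hxT' : x ∉ T.erase u := fun h => hxT (Finset.mem_of_mem_erase h)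
        rw [← ha (insert x (T.erase u))]
        · refine Finset.sum_congr rfl fun i _ => ?_
          have h1 := Finset.mul_prod_erase T (fun y => z y i) hu
          have h2 : z u i * b.repr (S u) i = 1 := inv_mul_cancel₀ (hb0 u (hTκ u hu) i)
          rw [Finset.prod_insert hxT']
          change a i * (∏ y ∈ T, z y i) * b.repr (S u) i * z x i = a i * (z x i * ∏ y ∈ T.erase u, z y i)
          linear_combination a i * (∏ y ∈ T.erase u, z y i) * z x i * h2 -
            a i * b.repr (S u) i * z x i * h1
        · rw [Finset.card_insert_of_notMem hxT', Finset.card_erase_of_mem hu]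
          omega
        · intro i h
          rcases Finset.mem_insert.1 h with h | h
          · exact hx i h
          · exact hTκ _ (Finset.mem_of_mem_erase h) i rfl
  set W : Matrix T (Fin (r + 2)) F := Matrix.of fun u i => g i * b.repr (S u) i with hW
  have hWli : LinearIndependent F W.row := by
    set f : (Fin (r + 2) → F) →ₗ[F] (Fin (r + 2) → F) :=
      LinearMap.pi (fun i => g i • b.coord i) with hf
    have hfker : LinearMap.ker f = ⊥ := by
      rw [LinearMap.ker_eq_bot']
      intro v hv
      apply b.ext_elem
      intro i
      have := congrFun hv i
      simpa [hf, hg0 i] using this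
    set eT := T.equivFinOfCardEq hTc with heT
    have h1 := hS.general.comp (m := r) (by omega) hS.1 (f := fun i => ((eT.symm i : T) : Fin n))
      (fun i j hij => eT.symm.injective (Subtype.ext hij))
    have h2 := (h1.comp eT eT.injective).map' f hfker
    have h3 : W.row = f ∘ (S ∘ fun i => ((eT.symm i : T) : Fin n)) ∘ eT := by
      ext u i
      simp [hW, hf, Matrix.row]
    rw [h3]
    exact h2
  have hrank : Module.finrank F (LinearMap.ker W.mulVecLin) = 2 := by
    have h1 := W.mulVecLin.finrank_range_add_finrank_ker
    have h2 : W.rank = r := by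
      rw [hWli.rank_matrix, Fintype.card_coe, hTc]
    rw [← Matrix.rank, h2, Module.finrank_fin_fun] at h1
    omega
  have hker : ∀ x, (∀ i, κ i ≠ x) → x ∉ T → z x ∈ LinearMap.ker W.mulVecLin := by
    intro x hx hxT
    rw [LinearMap.mem_ker]
    ext u
    exact hg u u.2 x hx hxT
  have hzli : LinearIndependent F ![z y₀, z y₁] := by
    rw [LinearIndependent.pair_iff]
    intro s t hst
    have h1 : t • S y₀ + s • S y₁ = 0 := by
      apply b.ext_elem
      intro i
      have h2 := congrFun hst i
      have h3 := hb0 y₀ hy₀ i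
      have h4 := hb0 y₁ hy₁ i
      simp only [hz, Pi.add_apply, Pi.smul_apply, smul_eq_mul, Pi.zero_apply] at h2
      field_simp at h2
      simp only [map_add, map_smul, Finsupp.add_apply, Finsupp.smul_apply, smul_eq_mul, map_zero,
        Finsupp.zero_apply]
      linear_combination h2
    exact (LinearIndependent.pair_iff.1 (hS.linearIndependent_pair (by omega) h01) t s h1).symm
  have hspan : Submodule.span F (Set.range ![z y₀, z y₁]) = LinearMap.ker W.mulVecLin := by
    apply Submodule.eq_of_le_of_finrank_eq
    · rw [Submodule.span_le]
      rintro _ ⟨i, rfl⟩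
      fin_cases i
      · exact hker y₀ hy₀ hTy.2.1
      · exact hker y₁ hy₁ hTy.2.2
    · rw [finrank_span_eq_card hzli, hrank, Fintype.card_fin]
  have hmem := hker y hy hTy.1
  rw [← hspan, Matrix.range_cons, Matrix.range_cons, Matrix.range_empty, Set.union_empty,
    Set.singleton_union, Submodule.mem_span_pair] at hmem
  obtain ⟨s, t, hst⟩ := hmem
  exact ⟨s, t, fun i => (congrFun hst i).symm⟩

/-- Two coordinates of two vectors outside the basis are never proportional. -/
theorem coord_mul_ne {S : Fin n → Fin (r + 2) → F} (hS : IsArc S)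
    (κ : Fin (r + 2) ↪ Fin n) (b : Module.Basis (Fin (r + 2)) F (Fin (r + 2) → F))
    (hb : ∀ i, b i = S (κ i)) (hb0 : ∀ y, (∀ i, κ i ≠ y) → ∀ i, b.repr (S y) i ≠ 0)
    {y₀ y₁ : Fin n} (h01 : y₀ ≠ y₁) (hy₀ : ∀ i, κ i ≠ y₀) (hy₁ : ∀ i, κ i ≠ y₁)
    {i j : Fin (r + 2)} (hij : i ≠ j) :
    b.repr (S y₁) i * b.repr (S y₀) j ≠ b.repr (S y₀) i * b.repr (S y₁) j := by
  intro h
  set I := (Finset.univ.erase i).erase j with hI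
  have hy₁I : y₁ ∉ I.map κ := by
    intro hm
    obtain ⟨x, _, hx⟩ := Finset.mem_map.1 hm
    exact hy₁ x hx
  have hIc : I.card = r := by
    rw [hI, Finset.card_erase_of_mem (by simp [hij.symm]), Finset.card_erase_of_mem (by simp),
      Finset.card_univ, Fintype.card_fin]
    omega
  have hCc : (insert y₁ (I.map κ)).card = r + 1 := by
    rw [Finset.card_insert_of_notMem hy₁I, Finset.card_map, hIc]
  have hy₀C : y₀ ∉ insert y₁ (I.map κ) := by
    rw [Finset.mem_insert, not_or]
    refine ⟨h01, fun hm => ?_⟩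
    obtain ⟨x, _, hx⟩ := Finset.mem_map.1 hm
    exact hy₀ x hx
  set φ := facet S (insert y₁ (I.map κ)) with hφ
  have h1 : φ (S y₀) ≠ 0 := facet_ne_zero hS.general hCc hy₀C
  have h2 : φ (S y₁) = 0 := facet_self S (Finset.mem_insert_self _ _)
  set v := b.repr (S y₁) i • S y₀ - b.repr (S y₀) i • S y₁ with hv
  have h3 : φ v = 0 := by
    rw [← b.sum_repr v, map_sum]
    refine Finset.sum_eq_zero fun x _ => ?_
    by_cases hxi : x = i
    · subst hxi
      simp only [hv, map_sub, map_smul, Finsupp.sub_apply, Finsupp.smul_apply, smul_eq_mul]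
      rw [mul_comm (b.repr (S y₁) x), sub_self, zero_mul]
    · by_cases hxj : x = j
      · subst hxj
        have : b.repr v x = 0 := by
          simp only [hv, map_sub, map_smul, Finsupp.sub_apply, Finsupp.smul_apply, smul_eq_mul]
          rw [h, sub_self]
        rw [this, zero_smul, map_zero]
      · rw [map_smul, hb, hφ, facet_self, smul_zero]
        refine Finset.mem_insert_of_mem (Finset.mem_map_of_mem κ ?_)
        simp [hI, hxi, hxj]
  rw [hv, map_sub, map_smul, map_smul, h2, smul_zero, sub_zero, smul_eq_mul] at h3
  exact mul_ne_zero (hb0 y₁ hy₁ i) h1 h3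

open Polynomial in
theorem linearlyEquivalent_normalRationalCurve_of_le [Fintype F] (p : ℕ) [CharP F p] (hrp : r + 1 < p)
    (hq : 2 * r + 4 ≤ Fintype.card F) (e : Fin (Fintype.card F) ≃ F)
    {S : Fin (Fintype.card F + 1) → Fin (r + 2) → F} (hS : IsArc S) :
    LinearlyEquivalent S (normalRationalCurve (r + 2) e) := by
  classical
  set κ : Fin (r + 2) ↪ Fin (Fintype.card F + 1) := Fin.castLEEmb hS.1 with hκ
  have hli : LinearIndependent F (S ∘ κ) := hS.general.comp le_rfl hS.1 κ.injective
  set b : Module.Basis (Fin (r + 2)) F (Fin (r + 2) → F) :=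
    basisOfLinearIndependentOfCardEqFinrank hli (by simp) with hbdef
  have hb : ∀ i, b i = S (κ i) := fun i => by simp [hbdef]
  have hb0 : ∀ y, (∀ i, κ i ≠ y) → ∀ i, b.repr (S y) i ≠ 0 := by
    intro y hy i h
    set C := (Finset.univ.erase i).map κ with hC
    have hCc : C.card = r + 1 := by simp [hC]
    have hyC : y ∉ C := by
      intro hm
      obtain ⟨x, _, hx⟩ := Finset.mem_map.1 hm
      exact hy x hx
    apply facet_ne_zero hS.general hCc hyC
    rw [← b.sum_repr (S y), map_sum]
    refine Finset.sum_eq_zero fun x _ => ?_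
    by_cases hxi : x = i
    · rw [hxi, h, zero_smul, map_zero]
    · rw [map_smul, hb, facet_self, smul_zero]
      exact Finset.mem_map_of_mem κ (by simp [hxi])
  obtain ⟨y₀, hy₀', y₁, hy₁', h01⟩ : ∃ y₀ ∈ (Finset.univ.map κ)ᶜ, ∃ y₁ ∈ (Finset.univ.map κ)ᶜ,
      y₀ ≠ y₁ := by
    rw [← Finset.one_lt_card, Finset.card_compl, Finset.card_map, Finset.card_univ,
      Fintype.card_fin, Fintype.card_fin]
    omega
  have hy₀ : ∀ i, κ i ≠ y₀ := fun i h =>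
    Finset.mem_compl.1 hy₀' (h ▸ Finset.mem_map_of_mem κ (Finset.mem_univ i))
  have hy₁ : ∀ i, κ i ≠ y₁ := fun i h =>
    Finset.mem_compl.1 hy₁' (h ▸ Finset.mem_map_of_mem κ (Finset.mem_univ i))
  set β : Fin (r + 2) → F := fun i => (b.repr (S y₀) i)⁻¹ with hβ
  set γ : Fin (r + 2) → F := fun i => (b.repr (S y₁) i)⁻¹ with hγ
  have hβ0 : ∀ i, β i ≠ 0 := fun i => inv_ne_zero (hb0 y₀ hy₀ i)
  have hγ0 : ∀ i, γ i ≠ 0 := fun i => inv_ne_zero (hb0 y₁ hy₁ i)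
  have hβγ : ∀ i j, i ≠ j → β i * γ j ≠ γ i * β j := by
    intro i j hij h
    have h1 := hb0 y₀ hy₀ i
    have h2 := hb0 y₁ hy₁ i
    have h3 := hb0 y₀ hy₀ j
    have h4 := hb0 y₁ hy₁ j
    simp only [hβ, hγ] at h
    field_simp at h
    refine coord_mul_ne hS κ b hb hb0 h01 hy₀ hy₁ hij ?_
    linear_combination h
  set P : Fin (r + 2) → F[X] := fun i => ∏ x ∈ Finset.univ.erase i, (C (γ x) * X + C (β x)) with hP
  have hPdeg : ∀ i, (P i).natDegree ≤ r + 1 := by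
    intro i
    refine (Polynomial.natDegree_prod_le _ _).trans ?_
    refine (Finset.sum_le_card_nsmul _ _ 1 fun x _ => Polynomial.natDegree_linear_le).trans ?_
    simp
  have hPlead : ∀ i, (P i).coeff (r + 1) = ∏ x ∈ Finset.univ.erase i, γ x := by
    intro i
    have h1 := Polynomial.coeff_prod_of_natDegree_le (s := Finset.univ.erase i)
      (fun x => C (γ x) * X + C (β x)) 1 (fun x _ => Polynomial.natDegree_linear_le)
    rw [Finset.card_erase_of_mem (Finset.mem_univ i), Finset.card_univ, Fintype.card_fin] at h1
    simpa using h1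
  have hPeval : ∀ i τ, (P i).eval τ = ∏ x ∈ Finset.univ.erase i, (γ x * τ + β x) := by
    intro i τ
    simp [hP, Polynomial.eval_prod]
  set L : (Fin (r + 2) → F) →ₗ[F] (Fin (r + 2) → F) :=
    b.equivFun.symm.toLinearMap ∘ₗ
      Matrix.mulVecLin (Matrix.of fun i j : Fin (r + 2) => (P i).coeff j) with hL
  have hLrepr : ∀ v i, b.repr (L v) i = ∑ j : Fin (r + 2), (P i).coeff j * v j := by
    intro v i
    change b.equivFun (L v) i = _
    simp only [hL, LinearMap.comp_apply, LinearEquiv.coe_coe, LinearEquiv.apply_symm_apply]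
    rfl
  have hLfin : ∀ τ i, b.repr (L (normalRationalCurve (r + 2) e (e.symm τ).castSucc)) i =
      ∏ x ∈ Finset.univ.erase i, (γ x * τ + β x) := by
    intro τ i
    rw [hLrepr, ← hPeval, Polynomial.eval_eq_sum_range' (Nat.lt_succ_of_le (hPdeg i)),
      normalRationalCurve_castSucc, Finset.sum_range]
    simp
  have hLinf : ∀ i, b.repr (L (normalRationalCurve (r + 2) e (Fin.last _))) i =
      ∏ x ∈ Finset.univ.erase i, γ x := by
    intro i
    rw [hLrepr, ← hPlead, normalRationalCurve_last, Finset.sum_eq_single (Fin.last (r + 1))]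
    · simp
    · intro j _ hj
      have : (j : ℕ) ≠ r + 1 := fun h => hj (Fin.ext h)
      simp [this]
    · simp
  refine hS.linearlyEquivalent (by omega) L fun y => ?_
  by_cases hy : ∃ i, κ i = y
  · obtain ⟨i, rfl⟩ := hy
    set τ := -β i / γ i with hτ
    have hzero : γ i * τ + β i = 0 := by
      have := hγ0 i
      rw [hτ]
      field_simp
      ring
    have hne : ∏ x ∈ Finset.univ.erase i, (γ x * τ + β x) ≠ 0 := by
      refine Finset.prod_ne_zero_iff.2 fun x hx h => ?_
      refine hβγ x i (Finset.ne_of_mem_erase hx) ?_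
      linear_combination γ i * h - γ x * hzero
    refine ⟨(e.symm τ).castSucc, (∏ x ∈ Finset.univ.erase i, (γ x * τ + β x))⁻¹, ?_⟩
    apply b.ext_elem
    intro j
    rw [map_smul, Finsupp.smul_apply, hLfin, ← hb, Module.Basis.repr_self, smul_eq_mul]
    by_cases hji : j = i
    · rw [hji, Finsupp.single_eq_same, inv_mul_cancel₀ hne]
    · rw [Finsupp.single_eq_of_ne hji, Finset.prod_eq_zero (Finset.mem_erase.2
        ⟨Ne.symm hji, Finset.mem_univ i⟩) hzero, mul_zero]
  · push Not at hy
    obtain ⟨s, t, hst⟩ := exists_inv_coord_eq p hrp rfl hq hS κ b hb hb0 h01 hy₀ hy₁ hy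
    have hprod : ∀ f : Fin (r + 2) → F, ∀ c, (∀ i, (b.repr (S y) i)⁻¹ = c * f i) → ∀ i,
        b.repr (S y) i = (c * ∏ x, f x)⁻¹ * ∏ x ∈ Finset.univ.erase i, f x := by
      intro f c hf i
      have hcf : ∀ i, c * f i ≠ 0 := fun i => hf i ▸ inv_ne_zero (hb0 y hy i)
      have h1 : ∏ x ∈ Finset.univ.erase i, f x ≠ 0 :=
        Finset.prod_ne_zero_iff.2 fun x _ => right_ne_zero_of_mul (hcf x)
      have h2 := left_ne_zero_of_mul (hcf i)
      have h3 := right_ne_zero_of_mul (hcf i)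
      rw [← Finset.mul_prod_erase _ _ (Finset.mem_univ i), ← inv_inv (b.repr (S y) i), hf i]
      field_simp
    by_cases hs : s = 0
    · refine ⟨Fin.last _, (t * ∏ x, γ x)⁻¹, ?_⟩
      apply b.ext_elem
      intro i
      rw [map_smul, Finsupp.smul_apply, hLinf, smul_eq_mul]
      exact hprod γ t (fun i => by rw [hst i, hs, zero_mul, zero_add]) i
    · refine ⟨(e.symm (t / s)).castSucc, (s * ∏ x, (γ x * (t / s) + β x))⁻¹, ?_⟩
      apply b.ext_elem
      intro i
      rw [map_smul, Finsupp.smul_apply, hLfin, smul_eq_mul]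
      refine hprod (fun x => γ x * (t / s) + β x) s (fun i => ?_) i
      rw [hst i]
      simp only [hβ, hγ]
      field_simp
      ring

end Direct

section Duality

variable {F : Type*} [Field F] {k l n : ℕ}

theorem IsArc.finrank_ker_linearCombination {S : Fin n → Fin k → F} (hS : IsArc S)
    (hkl : k + l = n) : Module.finrank F (LinearMap.ker (Fintype.linearCombination F S)) = l := by
  have h1 := (Fintype.linearCombination F S).finrank_range_add_finrank_ker
  rw [Fintype.range_linearCombination, hS.span_range_eq_top, finrank_top, Module.finrank_fin_fun,
    Module.finrank_fin_fun] at h1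
  omega

/-- The dual of an arc. -/
theorem IsArc.exists_dual {S : Fin n → Fin k → F} (hS : IsArc S) (hkl : k + l = n) :
    ∃ S' : Fin n → Fin l → F, IsArc S' ∧ ∀ a b, ∑ i, S i a * S' i b = 0 := by
  classical
  set B := Module.finBasisOfFinrankEq F _ (hS.finrank_ker_linearCombination hkl) with hB
  have hker : ∀ w : LinearMap.ker (Fintype.linearCombination F S), ∑ i, w.1 i • S i = 0 :=
    fun w => w.2
  refine ⟨fun i b => (B b).1 i, General.isArc (by omega) fun I hI => ?_, fun a b => ?_⟩
  · set f := I.orderIsoOfFin hI with hf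
    rw [← linearIndependent_equiv f.toEquiv]
    have h1 : IsUnit (Matrix.of fun i b : Fin l => (B b).1 (f i)) := by
      rw [← Matrix.mulVec_injective_iff_isUnit]
      refine (injective_iff_map_eq_zero
        (Matrix.mulVecLin (Matrix.of fun i b : Fin l => (B b).1 (f i)))).2 fun c hc => ?_
      set w := ∑ b, c b • B b with hw
      have hwi : ∀ i, w.1 i = ∑ b, c b * (B b).1 i := by
        intro i
        simp [hw, Finset.sum_apply]
      have hwI : ∀ i ∈ I, w.1 i = 0 := by
        intro i hi
        have h2 := congrFun hc (f.symm ⟨i, hi⟩)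
        rw [hwi]
        simp only [Matrix.mulVecLin_apply, Matrix.mulVec, dotProduct, Matrix.of_apply,
          OrderIso.apply_symm_apply, Pi.zero_apply] at h2
        rw [← h2]
        exact Finset.sum_congr rfl fun b _ => mul_comm _ _
      have hw0 : w.1 = 0 := by
        have h3 := hker w
        rw [← Finset.sum_add_sum_compl I, Finset.sum_eq_zero fun i hi => by
          rw [hwI i hi, zero_smul], zero_add, ← Finset.sum_coe_sort] at h3
        have h4 := Fintype.linearIndependent_iff.1 (hS.general Iᶜ (by
          rw [Finset.card_compl, hI, Fintype.card_fin]
          omega)) (fun i => w.1 i) h3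
        ext i
        by_cases hi : i ∈ I
        · exact hwI i hi
        · exact h4 ⟨i, Finset.mem_compl.2 hi⟩
      have h5 : w = 0 := Subtype.ext hw0
      ext b
      exact Fintype.linearIndependent_iff.1 B.linearIndependent c h5 b
    exact Matrix.linearIndependent_rows_iff_isUnit.2 h1
  · have := congrFun (hker (B b)) a
    simp only [Finset.sum_apply, Pi.smul_apply, smul_eq_mul, Pi.zero_apply] at this
    rw [← this]
    exact Finset.sum_congr rfl fun i _ => mul_comm _ _

/-- Arcs with linearly equivalent duals are linearly equivalent. -/
theorem linearlyEquivalent_of_dual (hk : 2 ≤ k) (hkl : k + l = n) {S R : Fin n → Fin k → F}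
    {S' R' : Fin n → Fin l → F} (hS : IsArc S) (hR : IsArc R) (hR' : IsArc R')
    (hSS' : ∀ a b, ∑ i, S i a * S' i b = 0) (hRR' : ∀ a b, ∑ i, R i a * R' i b = 0)
    (h : LinearlyEquivalent S' R') : LinearlyEquivalent S R := by
  obtain ⟨A, σ, c, hA⟩ := h
  set g := Fintype.linearCombination F R' with hg
  have hker : Module.finrank F (LinearMap.ker g) = k :=
    hR'.finrank_ker_linearCombination (by omega)
  have hu : ∀ a, (fun j => (c j : F)⁻¹ * S (σ j) a) ∈ LinearMap.ker g := by
    intro a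
    rw [LinearMap.mem_ker, hg, Fintype.linearCombination_apply]
    have h1 : ∀ j, ((c j : F)⁻¹ * S (σ j) a) • R' j =
        Matrix.mulVecLin (A : Matrix (Fin l) (Fin l) F) (S (σ j) a • S' (σ j)) := by
      intro j
      rw [hA j, smul_smul, mul_right_comm, inv_mul_cancel₀ (c j).ne_zero, one_mul, map_smul]
      rfl
    rw [Finset.sum_congr rfl fun j _ => h1 j, ← map_sum,
      Equiv.sum_comp σ (fun i => S i a • S' i)]
    have h2 : ∑ i, S i a • S' i = 0 := by
      ext b
      simpa using hSS' a b
    rw [h2, map_zero]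
  set f : (Fin k → F) →ₗ[F] (Fin n → F) := Matrix.mulVecLin (Matrix.of R) with hf
  have hfi : Function.Injective f := by
    rw [injective_iff_map_eq_zero]
    intro v hv
    have h1 : Submodule.span F (Set.range R) ≤ LinearMap.ker (dotProductBilin F F v) := by
      rw [Submodule.span_le]
      rintro _ ⟨j, rfl⟩
      have := congrFun hv j
      simpa [hf, Matrix.mulVec, dotProduct_comm] using this
    rw [hR.span_range_eq_top] at h1
    ext b
    have h2 := h1 (show Pi.single b (1 : F) ∈ ⊤ from trivial)
    simpa using h2
  have hrange : LinearMap.range f = LinearMap.ker g := by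
    apply Submodule.eq_of_le_of_finrank_eq
    · rintro _ ⟨v, rfl⟩
      rw [LinearMap.mem_ker, hg, Fintype.linearCombination_apply]
      ext b
      simp only [hf, Matrix.mulVecLin_apply, Matrix.mulVec, dotProduct, Matrix.of_apply,
        Finset.sum_apply, Pi.smul_apply, smul_eq_mul, Pi.zero_apply, Finset.sum_mul]
      rw [Finset.sum_comm]
      refine Finset.sum_eq_zero fun a _ => ?_
      rw [← mul_zero (v a), ← hRR' a b, Finset.mul_sum]
      exact Finset.sum_congr rfl fun i _ => by ring
    · rw [LinearMap.finrank_range_of_inj hfi, hker, Module.finrank_fin_fun]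
  have hex : ∀ a, ∃ v, f v = fun j => (c j : F)⁻¹ * S (σ j) a := by
    intro a
    have := hu a
    rwa [← hrange] at this
  choose m hm using hex
  refine hS.linearlyEquivalent hk (Matrix.mulVecLin (Matrix.of m)) fun y =>
    ⟨σ.symm y, c (σ.symm y), ?_⟩
  ext a
  have h1 := congrFun (hm a) (σ.symm y)
  simp only [hf, Matrix.mulVecLin_apply, Matrix.mulVec, Matrix.of_apply,
    Equiv.apply_symm_apply] at h1
  simp only [Pi.smul_apply, Matrix.mulVecLin_apply, Matrix.mulVec, Matrix.of_apply, smul_eq_mul]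
  rw [dotProduct_comm, h1, ← mul_assoc, mul_inv_cancel₀ (c _).ne_zero, one_mul]

variable [Fintype F]

theorem sum_pow_card_sub_one : ∑ x : F, x ^ (Fintype.card F - 1) = -1 := by
  classical
  have hq : 1 < Fintype.card F := Fintype.one_lt_card
  have h1 : ∀ x : F, x ^ (Fintype.card F - 1) = 1 - if x = 0 then 1 else 0 := by
    intro x
    split_ifs with h
    · rw [h, zero_pow (by omega), sub_self]
    · rw [FiniteField.pow_card_sub_one_eq_one x h, sub_zero]
  rw [Finset.sum_congr rfl fun x _ => h1 x]
  simp

theorem sum_normalRationalCurve_mul (hkl : k + l = Fintype.card F + 1)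
    (e : Fin (Fintype.card F) ≃ F) (a : Fin k) (b : Fin l) :
    ∑ i, normalRationalCurve k e i a * normalRationalCurve l e i b = 0 := by
  have hq : 1 < Fintype.card F := Fintype.one_lt_card
  rw [Fin.sum_univ_castSucc, normalRationalCurve_last, normalRationalCurve_last]
  simp only [normalRationalCurve_castSucc, ← pow_add]
  rw [Equiv.sum_comp e (fun x => x ^ ((a : ℕ) + b))]
  have ha := a.isLt
  have hb := b.isLt
  by_cases h : (a : ℕ) + b = Fintype.card F - 1
  · rw [h, sum_pow_card_sub_one, if_pos (by omega), if_pos (by omega)]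
    ring
  · rw [FiniteField.sum_pow_lt_card_sub_one F _ (by omega)]
    by_cases ha' : (a : ℕ) + 1 = k
    · rw [if_neg (show ¬ (b : ℕ) + 1 = l by omega), mul_zero, add_zero]
    · rw [if_neg ha', zero_mul, add_zero]

end Duality

section Uniqueness

variable {F : Type*} [Field F] [Fintype F]

theorem linearlyEquivalent_normalRationalCurve_one (e : Fin (Fintype.card F) ≃ F)
    {S : Fin (Fintype.card F + 1) → Fin 1 → F} (hS : IsArc S) :
    LinearlyEquivalent S (normalRationalCurve 1 e) := by
  have h0 : ∀ j, S j 0 ≠ 0 := by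
    intro j h
    have := (hS.general.comp (f := fun _ : Fin 1 => j) le_rfl hS.1
      (Function.injective_of_subsingleton _)).ne_zero 0
    apply this
    ext i
    rw [Subsingleton.elim i 0]
    exact h
  refine ⟨1, 1, fun j => (Units.mk0 _ (h0 j))⁻¹, fun j => ?_⟩
  ext i
  rw [Subsingleton.elim i 0]
  have h1 : normalRationalCurve 1 e j 0 = 1 := by
    refine Fin.lastCases ?_ (fun j => ?_) j
    · rw [normalRationalCurve_last]
      simp
    · rw [normalRationalCurve_castSucc]
      simp
  simp [h1, h0 j]

theorem linearlyEquivalent_normalRationalCurve_of_two_mul_le (p : ℕ) [CharP F p] {k : ℕ}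
    (hk : 1 ≤ k) (hkp : k ≤ p) (hq : 2 * k ≤ Fintype.card F) (e : Fin (Fintype.card F) ≃ F)
    {S : Fin (Fintype.card F + 1) → Fin k → F} (hS : IsArc S) :
    LinearlyEquivalent S (normalRationalCurve k e) := by
  obtain _ | _ | r := k
  · omega
  · exact linearlyEquivalent_normalRationalCurve_one e hS
  · exact linearlyEquivalent_normalRationalCurve_of_le p (by omega) (by omega) e hS

theorem linearlyEquivalent_normalRationalCurve (p : ℕ) [CharP F p] {k : ℕ}
    (hk : 1 ≤ k) (hkp : k ≤ p) (hq : 2 * k ≠ Fintype.card F + 1) (e : Fin (Fintype.card F) ≃ F)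
    {S : Fin (Fintype.card F + 1) → Fin k → F} (hS : IsArc S) :
    LinearlyEquivalent S (normalRationalCurve k e) := by
  by_cases h : 2 * k ≤ Fintype.card F
  · exact linearlyEquivalent_normalRationalCurve_of_two_mul_le p hk hkp h e hS
  · obtain ⟨m, hp, hm⟩ := FiniteField.card F p
    have hp2 := hp.two_le
    have hqp : Fintype.card F = p := by
      rcases Nat.lt_or_ge 1 m with hm1 | hm1
      · have h1 : p ^ 2 ≤ p ^ (m : ℕ) := Nat.pow_le_pow_right hp.pos hm1
        rw [← hm] at h1
        nlinarith
      · have h1 : (m : ℕ) = 1 := le_antisymm hm1 m.pos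
        rw [hm, h1, pow_one]
    obtain ⟨l, hl⟩ := Nat.exists_eq_add_of_le (show k ≤ Fintype.card F + 1 by omega)
    obtain ⟨S', hS', hSS'⟩ := hS.exists_dual hl.symm
    exact linearlyEquivalent_of_dual (by omega) hl.symm hS
      (isArc_normalRationalCurve (by omega) e) (isArc_normalRationalCurve (by omega) e) hSS'
      (sum_normalRationalCurve_mul hl.symm e)
      (linearlyEquivalent_normalRationalCurve_of_two_mul_le p (by omega) (by omega) (by omega) e hS')

end Uniqueness

end Arcs

theorem mainTheorem5 {F : Type*} [Field F] [Fintype F] (p : ℕ) [CharP F p]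
    (k : ℕ) (hk : 1 ≤ k) (hkp : k ≤ p) :
    (∀ (G : Fin (2 * k - 2) → Fin k → F), Arcs.IsArc G →
      ∀ B : Module.Basis (Fin k) F (Fin k → F),
        ∃ v : Fin ((2 * k - 2).choose (k - 1)) → F,
          v ∈ Submodule.span F (Set.range (Arcs.matH B G 0).col) ∧
            ∀ i, v i = if (i : ℕ) < k then 1 else 0) ∧
    (2 * k ≠ Fintype.card F + 1 →
      ∀ e : Fin (Fintype.card F) ≃ F,
        Arcs.IsArc (Arcs.normalRationalCurve k e) ∧
          ∀ S : Fin (Fintype.card F + 1) → Fin k → F, Arcs.IsArc S →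
            Arcs.LinearlyEquivalent S (Arcs.normalRationalCurve k e)) := by
  refine ⟨fun G hG B => ?_, fun hq e => ⟨?_, fun S hS => ?_⟩⟩
  · obtain _ | _ | r := k
    · omega
    · exact absurd hG.1 (by omega)
    · exact Arcs.exists_mem_span_col_matH p r (by omega) _ (by omega) G B
  · obtain ⟨m, hp, hm⟩ := FiniteField.card F p
    have h1 : p ≤ Fintype.card F := hm ▸ Nat.le_self_pow m.ne_zero p
    exact Arcs.isArc_normalRationalCurve (by omega) e
  · exact Arcs.linearlyEquivalent_normalRationalCurve p hk hkp hq e hS
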